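/- Let $\mathbb K$ be $\mathbb R$ or $\mathbb C$, let $X,Y$ be Banach spaces over $\mathbb K$, and let $B_X,S_X$ denote the closed unit ball and the unit sphere of $X$. Let $\mathcal L(X,Y)$ be the space of bounded linear operators from $X$ to $Y$. **Definitions.** - $T\in\mathcal L(X,Y)$ is *absolutely strongly exposing*, $T\in\mathrm{ASE}(X,Y)$, if there is $x_0\in S_X$ such that every sequence $(x_n)\subseteq B_X$ with $\|Tx_n\|\to\|T\|$ has a subsequence converging in norm to $\lambda x_0$ for some $\lambda\in\mathbb K$ with $|\lambda|=1$. - $\mathrm{SE}(B_X)$ is the set of nonzero $x^*\in X^*$ for which there is $x_0\in B_X$ with $\operatorname{Re}x^*(x_0)=\sup_{B_X}\operatorname{Re}x^*$ and such that $x_n\to x_0$ in norm whenever $(x_n)\subseteq B_X$ and $\operatorname{Re}x^*(x_n)\to\operatorname{Re}x^*(x_0)$. - $X$ has *property [P]* if for every $\varepsilon>0$ there is $\eta>0$ such that for all $x^*\in S_{X^*}$, $x\in S_X$ with $\operatorname{Re}x^*(x)>1-\eta$ there are $y^*\in \mathrm{SE}(B_X)\cap S_{X^*}$ and $y\in S_X$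 with $y^*(y)=1$, $\|x^*-y^*\|<\varepsilon$ and $\|x-y\|<\varepsilon$. - A linear subspace $\mathcal M\subseteq\mathcal L(X,Y)$ has the *BPBp-ASE* if for every $\varepsilon>0$ there is $0<\eta<\varepsilon$ such that for all $T\in\mathcal M$ with $\|T\|=1$ and all $x\in S_X$ with $\|Tx\|>1-\eta$ there are $S\in\mathcal M\cap \mathrm{ASE}(X,Y)$ and $x_0\in S_X$ with $\|S\|=\|Sx_0\|=1$, $\|S-T\|<\varepsilon$ and $\|x-x_0\|<\varepsilon$. - A nonempty set $\Gamma\subseteq B_{Y^*}$ is *1-norming* if $\|y\|=\sup_{y^*\in\Gamma}|y^*(y)|$ for every $y\in Y$. - $Y$ has *$\mathrm{ACK}_\rho$ structure*, $0\le\rho<1$, *with the 1-norming set* $\Gamma\subseteq B_{Y^*}$ if for every $\varepsilon>0$ and every nonempty relatively $w^*$-open $U\subseteq\Gamma$ there are a nonempty $V\subseteq U$, $y_1^*\in V$, $e\in S_Y$ and $F\in\mathcal L(Y,Y)$ such that: (i) $\|Fe\|=\|F\|=1$; (ii) $y_1^*(Fe)=1$; (iii) $F^*y_1^*=y_1^*$;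 (iv) with $V_1=\{y^*\in\Gamma:\|F^*y^*\|+(1-\varepsilon)\|y^*-F^*y^*\|\le1\}$, $|y^*(Fe)|\le\rho$ for every $y^*\in\Gamma\setminus V_1$; (v) $\operatorname{dist}(F^*y^*,\operatorname{aconv}(\{0\}\cup V))<\varepsilon$ for every $y^*\in\Gamma$, where $\operatorname{aconv}$ is the absolutely convex hull; (vi) $|v^*(e)-1|\le\varepsilon$ for every $v^*\in V$. - $T\in\mathcal L(X,Y)$ is *$\Gamma$-flat*, $T\in\mathrm{Fl}_\Gamma(X,Y)$, if $T^*|_\Gamma:(\Gamma,w^*)\to(X^*,\|\cdot\|)$ is openly fragmented: for every nonempty relatively $w^*$-open $U\subseteq\Gamma$ and every $\varepsilon>0$ there is a nonempty relatively $w^*$-open $V\subseteq U$ such that $T^*(V)$ has norm diameter less than $\varepsilon$. - A linear subspace $\mathcal I\subseteq \mathrm{Fl}_\Gamma(X,Y)$ is a *$\Gamma$-flat ideal* if it contains all bounded finite-rank operators from $X$ to $Y$ and $F\circ T\in\mathcal I$ for all $T\in\mathcal I$, $F\in\mathcal L(Y,Y)$. **Theorem.** Suppose that $Y$ has $\mathrm{ACK}_\rho$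 structure, for some $\rho\in[0,1)$, with the 1-norming set $\Gamma$, and let $\mathcal I(X,Y)\subseteq\mathrm{Fl}_\Gamma(X,Y)$ be a $\Gamma$-flat ideal. Then $\mathcal I(X,Y)$ has the BPBp-ASE if and only if $X$ has property [P]. -/

import Mathlib

open Filter Topology Set

section Definitions

variable {𝕜 : Type*} [RCLike 𝕜]
variable {X : Type*} [NormedAddCommGroup X] [NormedSpace 𝕜 X]
variable {Y : Type*} [NormedAddCommGroup Y] [NormedSpace 𝕜 Y]

/-- `T` is absolutely strongly exposing: there is a unit vector `x₀` such that every sequence in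
the closed unit ball along which `‖T x‖` tends to `‖T‖` has a subsequence converging in norm to
some unimodular multiple of `x₀`. -/
def IsASE (T : X →L[𝕜] Y) : Prop :=
  ∃ x₀ : X, ‖x₀‖ = 1 ∧ ∀ x : ℕ → X, (∀ n, ‖x n‖ ≤ 1) →
    Tendsto (fun n => ‖T (x n)‖) atTop (𝓝 ‖T‖) →
      ∃ σ : ℕ → ℕ, StrictMono σ ∧ ∃ c : 𝕜, ‖c‖ = 1 ∧
        Tendsto (fun n => x (σ n)) atTop (𝓝 (c • x₀))

/-- The functional `f` strongly exposes the point `x₀` in the set `C`. -/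
def StronglyExposes (f : StrongDual 𝕜 X) (C : Set X) (x₀ : X) : Prop :=
  f ≠ 0 ∧ x₀ ∈ C ∧ IsLUB ((fun x => RCLike.re (f x)) '' C) (RCLike.re (f x₀)) ∧
    ∀ x : ℕ → X, (∀ n, x n ∈ C) →
      Tendsto (fun n => RCLike.re (f (x n))) atTop (𝓝 (RCLike.re (f x₀))) →
        Tendsto x atTop (𝓝 x₀)

variable (𝕜) in
/-- `SE(C)`: the set of strongly exposing functionals of `C`. -/
def stronglyExposingFunctionals (C : Set X) : Set (StrongDual 𝕜 X) :=
  {f | ∃ x₀, StronglyExposes f C x₀}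

variable (𝕜 X) in
/-- Property [P]: the Bishop-Phelps-Bollobás theorem with strongly exposing functionals (of norm
one) of the closed unit ball. -/
def PropertyP : Prop :=
  ∀ ε : ℝ, 0 < ε → ∃ η : ℝ, 0 < η ∧
    ∀ (f : StrongDual 𝕜 X) (x : X), ‖f‖ = 1 → ‖x‖ = 1 → 1 - η < RCLike.re (f x) →
      ∃ g ∈ stronglyExposingFunctionals 𝕜 (Metric.closedBall (0 : X) 1), ∃ y : X,
        ‖g‖ = 1 ∧ ‖y‖ = 1 ∧ g y = 1 ∧ ‖f - g‖ < ε ∧ ‖x - y‖ < ε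

/-- The Bishop-Phelps-Bollobás property for absolutely strongly exposing operators, for a linear
subspace `M` of the space of bounded operators from `X` to `Y`. -/
def HasBPBpASE (M : Submodule 𝕜 (X →L[𝕜] Y)) : Prop :=
  ∀ ε : ℝ, 0 < ε → ∃ η : ℝ, 0 < η ∧ η < ε ∧
    ∀ T ∈ M, ‖T‖ = 1 → ∀ x : X, ‖x‖ = 1 → 1 - η < ‖T x‖ →
      ∃ S ∈ M, IsASE S ∧ ∃ x₀ : X,
        ‖x₀‖ = 1 ∧ ‖S‖ = 1 ∧ ‖S x₀‖ = 1 ∧ ‖S - T‖ < ε ∧ ‖x - x₀‖ < ε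

/-- `Γ` is a 1-norming subset of the closed unit ball of the dual of `Y`. -/
def IsOneNorming (Γ : Set (StrongDual 𝕜 Y)) : Prop :=
  (∀ f ∈ Γ, ‖f‖ ≤ 1) ∧ ∀ y : Y, IsLUB ((fun f : StrongDual 𝕜 Y => ‖f y‖) '' Γ) ‖y‖

/-- `U` is a relatively weak-star open subset of `Γ`. -/
def IsRelWeakStarOpen (Γ U : Set (StrongDual 𝕜 Y)) : Prop :=
  ∃ O : Set (WeakDual 𝕜 Y), IsOpen O ∧ U = Γ ∩ StrongDual.toWeakDual ⁻¹' O

open scoped ComplexOrder in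
/-- `Y` has ACK structure with parameter `ρ` and corresponding 1-norming set `Γ`.
The adjoint of `F` sends the functional `f` to `f ∘L F`. The scoped order on `𝕜` is the one for
which `a ≤ b` means that `b - a` is a nonnegative real, so that convexity over `𝕜` is ordinary
real convexity, and `absConvexHull 𝕜` is the usual absolutely convex hull. -/
def HasACKStructure (ρ : ℝ) (Γ : Set (StrongDual 𝕜 Y)) : Prop :=
  0 ≤ ρ ∧ ρ < 1 ∧ IsOneNorming Γ ∧
    ∀ ε : ℝ, 0 < ε → ∀ U : Set (StrongDual 𝕜 Y), U.Nonempty → IsRelWeakStarOpen Γ U →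
      ∃ V : Set (StrongDual 𝕜 Y), V.Nonempty ∧ V ⊆ U ∧
        ∃ f₁ ∈ V, ∃ e : Y, ‖e‖ = 1 ∧ ∃ F : Y →L[𝕜] Y,
          ‖F e‖ = 1 ∧ ‖F‖ = 1 ∧
          f₁ (F e) = 1 ∧
          f₁ ∘L F = f₁ ∧
          (∀ f ∈ Γ, ¬ (‖f ∘L F‖ + (1 - ε) * ‖f - f ∘L F‖ ≤ 1) → ‖f (F e)‖ ≤ ρ) ∧
          (∀ f ∈ Γ, Metric.infDist (f ∘L F) (absConvexHull 𝕜 (insert 0 V)) < ε) ∧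
          (∀ v ∈ V, ‖v e - 1‖ ≤ ε)

/-- A map from a topological space to a metric space is openly fragmented if every nonempty open
set contains nonempty open subsets with images of arbitrarily small diameter. -/
def OpenlyFragmented {A M : Type*} [TopologicalSpace A] [PseudoMetricSpace M] (φ : A → M) : Prop :=
  ∀ U : Set A, IsOpen U → U.Nonempty → ∀ ε : ℝ, 0 < ε →
    ∃ V : Set A, IsOpen V ∧ V.Nonempty ∧ V ⊆ U ∧ Metric.ediam (φ '' V) < ENNReal.ofReal ε

/-- `T` is `Γ`-flat: the restriction to `Γ` of the adjoint `f ↦ f ∘L T` is openly fragmented from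
the weak-star topology of `Γ` to the norm topology of the dual of `X`. -/
def IsFlat (Γ : Set (StrongDual 𝕜 Y)) (T : X →L[𝕜] Y) : Prop :=
  OpenlyFragmented (fun f : {f : WeakDual 𝕜 Y // WeakDual.toStrongDual f ∈ Γ} =>
    (WeakDual.toStrongDual f.1) ∘L T)

/-- `I` is a `Γ`-flat ideal of operators from `X` to `Y`. -/
def IsFlatIdeal (Γ : Set (StrongDual 𝕜 Y)) (I : Submodule 𝕜 (X →L[𝕜] Y)) : Prop :=
  (∀ T ∈ I, IsFlat Γ T) ∧
  (∀ T : X →L[𝕜] Y, FiniteDimensional 𝕜 (LinearMap.range (T : X →ₗ[𝕜] Y)) → T ∈ I) ∧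
  (∀ T ∈ I, ∀ F : Y →L[𝕜] Y, F ∘L T ∈ I)

end Definitions

section Auxiliary

variable {𝕜 : Type*} [RCLike 𝕜]
variable {X : Type*} [NormedAddCommGroup X] [NormedSpace 𝕜 X]
variable {Y : Type*} [NormedAddCommGroup Y] [NormedSpace 𝕜 Y]

theorem RCLike.norm_sub_one_sq_le {z : 𝕜} (hz : ‖z‖ ≤ 1) :
    ‖z - 1‖ ^ 2 ≤ 2 * (1 - RCLike.re z) := by
  have h := RCLike.norm_sq_eq_def (K := 𝕜) (z := z)
  have h' := RCLike.norm_sq_eq_def (K := 𝕜) (z := z - 1)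
  simp only [map_sub, RCLike.one_re, RCLike.one_im, sub_zero] at h'
  nlinarith [norm_nonneg z]

theorem RCLike.eq_one_of_norm_le_of_one_le_re {z : 𝕜} (hz : ‖z‖ ≤ 1) (h : 1 ≤ RCLike.re z) :
    z = 1 := by
  have h1 := RCLike.norm_sub_one_sq_le hz
  have h2 : ‖z - 1‖ = 0 := by
    have : ‖z - 1‖ ^ 2 = 0 := le_antisymm (by linarith) (sq_nonneg _)
    simpa using this
  exact sub_eq_zero.1 (norm_eq_zero.1 h2)

theorem ContinuousLinearMap.norm_apply_le_of_unit (f : X →L[𝕜] Y) (hf : ‖f‖ ≤ 1) {x : X}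
    (hx : ‖x‖ ≤ 1) : ‖f x‖ ≤ 1 :=
  (f.le_of_opNorm_le_of_le hf hx).trans (by simp)

/-- A functional of norm one attaining the value one at a point of the unit ball strongly exposes
that point as soon as sequences along which it tends to its norm converge to that point. -/
theorem stronglyExposes_closedBall {g : StrongDual 𝕜 X} {y : X} (hg : ‖g‖ = 1) (hy : ‖y‖ ≤ 1)
    (hgy : g y = 1)
    (h : ∀ x : ℕ → X, (∀ n, ‖x n‖ ≤ 1) → Tendsto (fun n => RCLike.re (g (x n))) atTop (𝓝 1) →
      Tendsto x atTop (𝓝 y)) :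
    StronglyExposes g (Metric.closedBall (0 : X) 1) y := by
  refine ⟨fun h0 => by simp [h0] at hg, by simpa using hy, ⟨?_, fun b hb => ?_⟩, fun x hx hlim => ?_⟩
  · rintro _ ⟨x, hx, rfl⟩
    have := (RCLike.re_le_norm (g x)).trans
      (g.norm_apply_le_of_unit hg.le (by simpa using hx))
    simpa [hgy] using this
  · exact hb ⟨y, by simpa using hy, rfl⟩
  · exact h x (fun n => by simpa using hx n) (by simpa [hgy] using hlim)

/-- If `g` of norm one is strongly exposing and `g y = 1`, then sequences of the ball along which
`re g` tends to one converge to `y`. -/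
theorem tendsto_of_mem_stronglyExposing {g : StrongDual 𝕜 X} {y : X}
    (hse : g ∈ stronglyExposingFunctionals 𝕜 (Metric.closedBall (0 : X) 1)) (hg : ‖g‖ = 1)
    (hy : ‖y‖ ≤ 1) (hgy : g y = 1) {x : ℕ → X} (hx : ∀ n, ‖x n‖ ≤ 1)
    (hlim : Tendsto (fun n => RCLike.re (g (x n))) atTop (𝓝 1)) : Tendsto x atTop (𝓝 y) := by
  obtain ⟨z, -, hz, hlub, hseq⟩ := hse
  have h1 : RCLike.re (g z) = 1 := by
    refine le_antisymm ((RCLike.re_le_norm _).trans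
      (g.norm_apply_le_of_unit hg.le (by simpa using hz))) ?_
    have := hlub.1 ⟨y, by simpa using hy, rfl⟩
    simpa [hgy] using this
  rw [h1] at hseq
  have h2 := hseq (fun _ => y) (fun _ => by simpa using hy) (by simp [hgy])
  rw [tendsto_nhds_unique tendsto_const_nhds h2]
  exact hseq x (fun n => by simpa using hx n) hlim

theorem exists_subseq_tendsto_of_norm_tendsto {g : StrongDual 𝕜 X} {y : X}
    (hse : g ∈ stronglyExposingFunctionals 𝕜 (Metric.closedBall (0 : X) 1)) (hg : ‖g‖ = 1)
    (hy : ‖y‖ ≤ 1) (hgy : g y = 1) {x : ℕ → X} (hx : ∀ n, ‖x n‖ ≤ 1)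
    (hlim : Tendsto (fun n => ‖g (x n)‖) atTop (𝓝 1)) :
    ∃ σ : ℕ → ℕ, StrictMono σ ∧ ∃ c : 𝕜, ‖c‖ = 1 ∧
      Tendsto (fun n => x (σ n)) atTop (𝓝 (c • y)) := by
  obtain ⟨c, -, σ, hσ, hc⟩ := (isCompact_closedBall (0 : 𝕜) 1).tendsto_subseq
    (x := fun n => g (x n)) (fun n => by simpa using g.norm_apply_le_of_unit hg.le (hx n))
  have hc1 : ‖c‖ = 1 := tendsto_nhds_unique hc.norm (hlim.comp hσ.tendsto_atTop)
  have hc0 : c ≠ 0 := fun h => by simp [h] at hc1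
  refine ⟨σ, hσ, c, hc1, ?_⟩
  have key : Tendsto (fun n => c⁻¹ • x (σ n)) atTop (𝓝 y) := by
    refine tendsto_of_mem_stronglyExposing hse hg hy hgy (fun n => ?_) ?_
    · simpa [norm_smul, hc1] using hx (σ n)
    · have h1 : Tendsto (fun n => RCLike.re (c⁻¹ * g (x (σ n)))) atTop (𝓝 (RCLike.re (c⁻¹ * c))) :=
        (RCLike.continuous_re.tendsto _).comp (hc.const_mul c⁻¹)
      simpa [hc0] using h1
  simpa [smul_smul, hc0] using key.const_smul c

/-- Composing an absolutely strongly exposing operator of norm one with a functional that norms its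
value at a point of the unit sphere produces a strongly exposing functional. -/
theorem IsASE.comp_mem_stronglyExposing {S : X →L[𝕜] Y} (hS : IsASE S) (hS1 : ‖S‖ = 1) {x₀ : X}
    (hx₀ : ‖x₀‖ = 1) {h : StrongDual 𝕜 Y} (hh : ‖h‖ = 1) (hhx : h (S x₀) = 1) :
    ‖h ∘L S‖ = 1 ∧
      h ∘L S ∈ stronglyExposingFunctionals 𝕜 (Metric.closedBall (0 : X) 1) := by
  have hle : ‖h ∘L S‖ ≤ 1 := (h.opNorm_comp_le S).trans (by simp [hh, hS1])
  have hn : ‖h ∘L S‖ = 1 := by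
    refine le_antisymm hle ?_
    have := (h ∘L S).le_opNorm x₀
    simpa [hhx, hx₀] using this
  refine ⟨hn, x₀, stronglyExposes_closedBall hn hx₀.le hhx fun x hx hlim => ?_⟩
  obtain ⟨z, -, hzseq⟩ := hS
  rw [hS1] at hzseq
  have hle' : ∀ n, RCLike.re ((h ∘L S) (x n)) ≤ ‖S (x n)‖ := fun n =>
    (RCLike.re_le_norm _).trans ((h.le_of_opNorm_le hh.le _).trans (by simp))
  have hxS : ‖S x₀‖ = 1 := by
    refine le_antisymm (S.norm_apply_le_of_unit hS1.le hx₀.le) ?_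
    have := h.le_opNorm (S x₀)
    simpa [hhx, hh] using this
  obtain ⟨-, -, d, hd, hdlim⟩ := hzseq (fun _ => x₀) (fun _ => hx₀.le) (by simp [hxS])
  have hdx : x₀ = d • z := tendsto_nhds_unique tendsto_const_nhds hdlim
  have hd0 : d ≠ 0 := fun h => by simp [h] at hd
  have hSlim : Tendsto (fun n => ‖S (x n)‖) atTop (𝓝 1) :=
    tendsto_of_tendsto_of_tendsto_of_le_of_le hlim tendsto_const_nhds hle'
      (fun n => S.norm_apply_le_of_unit hS1.le (hx n))
  refine tendsto_of_subseq_tendsto fun ns hns => ?_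
  obtain ⟨σ, hσ, c, hc, hclim⟩ :=
    hzseq (fun n => x (ns n)) (fun n => hx _) (hSlim.comp hns)
  refine ⟨σ, ?_⟩
  have hcx : c • z = (c * d⁻¹) • x₀ := by rw [hdx, smul_smul, mul_assoc, inv_mul_cancel₀ hd0, mul_one]
  rw [hcx] at hclim
  have h1 : Tendsto (fun n => RCLike.re ((h ∘L S) (x (ns (σ n))))) atTop
      (𝓝 (RCLike.re ((h ∘L S) ((c * d⁻¹) • x₀)))) :=
    ((RCLike.continuous_re.comp (h ∘L S).continuous).tendsto _).comp hclim
  have h2 := tendsto_nhds_unique h1 (hlim.comp (hns.comp hσ.tendsto_atTop))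
  have h3 : c * d⁻¹ = 1 := by
    refine RCLike.eq_one_of_norm_le_of_one_le_re (by simp [hc, hd]) (le_of_eq ?_)
    rw [← h2]
    simp [hhx]
  simpa [h3] using hclim

theorem HasBPBpASE.propertyP [Nontrivial Y] {I : Submodule 𝕜 (X →L[𝕜] Y)}
    (hfin : ∀ T : X →L[𝕜] Y,
      FiniteDimensional 𝕜 (LinearMap.range (T : X →ₗ[𝕜] Y)) → T ∈ I)
    (h : HasBPBpASE I) : PropertyP 𝕜 X := by
  intro ε hε
  obtain ⟨η₁, hη₁, -, H⟩ := h (ε / 4) (by positivity)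
  obtain ⟨v, hv⟩ : ∃ v : Y, ‖v‖ = 1 := by
    obtain ⟨w, hw⟩ := exists_ne (0 : Y)
    exact ⟨_, norm_smul_inv_norm (𝕜 := 𝕜) hw⟩
  refine ⟨min η₁ (ε ^ 2 / 32), by positivity, fun f x hf hx hfx => ?_⟩
  have hfx1 : 1 - η₁ < RCLike.re (f x) := by linarith [min_le_left η₁ (ε ^ 2 / 32)]
  have hfx2 : 1 - ε ^ 2 / 32 < RCLike.re (f x) := by linarith [min_le_right η₁ (ε ^ 2 / 32)]
  have hTI : f.smulRight v ∈ I := by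
    apply hfin
    refine Submodule.finiteDimensional_of_le (S₂ := Submodule.span 𝕜 {v}) ?_
    rintro _ ⟨x, rfl⟩
    exact Submodule.smul_mem _ _ (Submodule.mem_span_singleton_self v)
  obtain ⟨S, -, hSA, x₀, hx₀, hS, hSx₀, hST, hxx₀⟩ := H (f.smulRight v) hTI
    (by simp [hf, hv]) x hx
    (by simpa [norm_smul, hv] using hfx1.trans_le (RCLike.re_le_norm _))
  have hS0 : ‖S x₀‖ ≠ 0 := by simp [hSx₀]
  obtain ⟨k, hk, hkS⟩ := exists_dual_vector 𝕜 (S x₀) hS0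
  have hkS1 : k (S x₀) = 1 := by simp [hkS, hSx₀]
  obtain ⟨hn, hmem⟩ := hSA.comp_mem_stronglyExposing hS hx₀ hk hkS1
  have hkv : ‖k v‖ ≤ 1 := k.norm_apply_le_of_unit hk.le hv.le
  have h1 : ‖f x - 1‖ < ε / 4 := by
    refine lt_of_pow_lt_pow_left₀ 2 (by positivity) ?_
    have := RCLike.norm_sub_one_sq_le (f.norm_apply_le_of_unit hf.le hx.le)
    linarith [show (ε / 4) ^ 2 = 2 * (ε ^ 2 / 32) by ring]
  have h2 : ‖f x - f x₀‖ < ε / 4 := by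
    rw [← map_sub]
    exact ((f.le_of_opNorm_le hf.le _).trans (by simp)).trans_lt hxx₀
  have h3 : ‖k ∘L S - k v • f‖ < ε / 4 := by
    have : k ∘L S - k v • f = k ∘L (S - f.smulRight v) := by
      ext z
      simp [mul_comm]
    rw [this]
    exact ((k.opNorm_comp_le _).trans (by simp [hk])).trans_lt hST
  have h4 : ‖1 - k v * f x₀‖ < ε / 4 := by
    have := ((k ∘L S - k v • f).le_opNorm x₀).trans_lt (by simpa [hx₀] using h3)
    simpa [hkS1] using this
  have h5 : ‖k v - 1‖ < 3 * (ε / 4) := by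
    have e : k v - 1 = k v * (-(f x - 1)) + k v * (f x - f x₀) + -(1 - k v * f x₀) := by ring
    have m1 : ‖k v * (-(f x - 1))‖ ≤ ‖f x - 1‖ := by
      rw [norm_mul, norm_neg]; exact mul_le_of_le_one_left (norm_nonneg _) hkv
    have m2 : ‖k v * (f x - f x₀)‖ ≤ ‖f x - f x₀‖ := by
      rw [norm_mul]; exact mul_le_of_le_one_left (norm_nonneg _) hkv
    rw [e]
    refine (norm_add₃_le).trans_lt ?_
    rw [norm_neg]
    linarith
  refine ⟨_, hmem, x₀, hn, hx₀, hkS1, ?_, by linarith⟩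
  have e : f - k ∘L S = -(k ∘L S - k v • f) - (k v - 1) • f := by
    ext z
    simp
    ring
  rw [e]
  refine (norm_sub_le _ _).trans_lt ?_
  rw [norm_neg, norm_smul, hf]
  linarith

open scoped ComplexOrder in
theorem absConvex_preimage_closedBall {E G : Type*} [NormedAddCommGroup E] [NormedSpace 𝕜 E]
    [NormedAddCommGroup G] [NormedSpace 𝕜 G] (φ : E →ₗ[𝕜] G) (r : ℝ) :
    AbsConvex 𝕜 {a | ‖φ a‖ ≤ r} := by
  refine ⟨balanced_iff_smul_mem.2 fun c hc a ha => ?_, fun a ha b hb s t hs ht hst => ?_⟩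
  · simp only [mem_ofPred_eq, map_smul, norm_smul] at ha ⊢
    exact (mul_le_of_le_one_left (norm_nonneg _) hc).trans ha
  · simp only [mem_ofPred_eq, map_add, map_smul] at ha hb ⊢
    have hs' : ‖s‖ + ‖t‖ = 1 := by
      have h1 := congrArg RCLike.re hst
      rw [map_add, RCLike.one_re] at h1
      rw [RCLike.nonneg_iff_exists_ofReal] at hs ht
      obtain ⟨u, hu, rfl⟩ := hs
      obtain ⟨w, hw, rfl⟩ := ht
      simpa [abs_of_nonneg hu, abs_of_nonneg hw] using h1
    calc ‖s • φ a + t • φ b‖ ≤ ‖s‖ * ‖φ a‖ + ‖t‖ * ‖φ b‖ := by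
          simpa [norm_smul] using norm_add_le (s • φ a) (t • φ b)
      _ ≤ ‖s‖ * r + ‖t‖ * r := by gcongr
      _ = r := by rw [← add_mul, hs', one_mul]

open scoped ComplexOrder in
/-- An operator that is small on `V` after composition is small on functionals close to the
absolutely convex hull of `V`. -/
theorem norm_comp_le_of_infDist_absConvexHull_lt {V : Set (StrongDual 𝕜 Y)} {R : X →L[𝕜] Y}
    {δ ε : ℝ} (hδ : 0 ≤ δ) (hV : ∀ v ∈ V, ‖v ∘L R‖ ≤ δ) {f : StrongDual 𝕜 Y}
    (hf : Metric.infDist f (absConvexHull 𝕜 (insert 0 V)) < ε) : ‖f ∘L R‖ ≤ ε * ‖R‖ + δ := by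
  have hne : (absConvexHull 𝕜 (insert (0 : StrongDual 𝕜 Y) V)).Nonempty :=
    ⟨0, subset_absConvexHull (mem_insert _ _)⟩
  obtain ⟨a, ha, hfa⟩ := (Metric.infDist_lt_iff hne).1 hf
  let φ : StrongDual 𝕜 Y →ₗ[𝕜] StrongDual 𝕜 X :=
    { toFun := fun f => f ∘L R
      map_add' := fun f g => by ext; simp
      map_smul' := fun c f => by ext; simp }
  have hsub : absConvexHull 𝕜 (insert 0 V) ⊆ {a | ‖φ a‖ ≤ δ} := by
    refine absConvexHull_min ?_ (absConvex_preimage_closedBall φ δ)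
    rintro v (rfl | hv)
    · simpa using hδ
    · exact hV v hv
  have e : f ∘L R = (f - a) ∘L R + a ∘L R := by ext; simp
  rw [e]
  refine (norm_add_le _ _).trans (add_le_add ?_ (hsub ha))
  refine ((f - a).opNorm_comp_le R).trans ?_
  gcongr
  rw [← dist_eq_norm]
  exact hfa.le

theorem IsOneNorming.norm_le {Γ : Set (StrongDual 𝕜 Y)} (hΓ : IsOneNorming Γ) {y : Y} {c : ℝ}
    (h : ∀ f ∈ Γ, ‖f y‖ ≤ c) : ‖y‖ ≤ c :=
  (hΓ.2 y).2 (by rintro _ ⟨f, hf, rfl⟩; exact h f hf)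

/-- A flat operator almost attaining its norm at `x` has adjoints of almost constant value on a
relatively weak-star open set of functionals that almost attain at the image of `x`. -/
theorem IsFlat.exists_relWeakStarOpen {Γ : Set (StrongDual 𝕜 Y)} (hΓ : IsOneNorming Γ)
    {T : X →L[𝕜] Y} (hT : IsFlat Γ T) {x : X} {c r : ℝ} (hc : c < ‖T x‖) (hr : 0 < r) :
    ∃ U : Set (StrongDual 𝕜 Y), U.Nonempty ∧ IsRelWeakStarOpen Γ U ∧
      (∀ f ∈ U, c < ‖f (T x)‖) ∧ ∀ f ∈ U, ∀ g ∈ U, ‖f ∘L T - g ∘L T‖ < r := by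
  have hopen : IsOpen {f : {f : WeakDual 𝕜 Y // WeakDual.toStrongDual f ∈ Γ} |
      c < ‖f.1 (T x)‖} :=
    isOpen_lt continuous_const
      (((WeakDual.eval_continuous (T x)).comp continuous_subtype_val).norm)
  obtain ⟨f, hf, hfc⟩ : ∃ f ∈ Γ, c < ‖f (T x)‖ := by
    by_contra! hcon
    exact absurd (hΓ.norm_le hcon) (not_le.2 hc)
  obtain ⟨V, hV, ⟨v, hv⟩, hVU, hd⟩ := hT _ hopen ⟨⟨StrongDual.toWeakDual f, hf⟩, hfc⟩ r hr
  obtain ⟨O, hO, rfl⟩ := isOpen_induced_iff.1 hV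
  refine ⟨Γ ∩ StrongDual.toWeakDual ⁻¹' O, ⟨WeakDual.toStrongDual v.1, v.2, hv⟩, ⟨O, hO, rfl⟩,
    ?_, ?_⟩
  · rintro f ⟨hf, hfO⟩
    exact hVU (show (⟨StrongDual.toWeakDual f, hf⟩ : {f : WeakDual 𝕜 Y // _}) ∈ _ from hfO)
  · rintro f ⟨hf, hfO⟩ g ⟨hg, hgO⟩
    rw [← dist_eq_norm, ← ENNReal.ofReal_lt_ofReal_iff hr, ← edist_dist]
    refine (Metric.edist_le_ediam_of_mem ?_ ?_).trans_lt hd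
    · exact ⟨⟨StrongDual.toWeakDual f, hf⟩, hfO, rfl⟩
    · exact ⟨⟨StrongDual.toWeakDual g, hg⟩, hgO, rfl⟩

/-- Property [P] for functionals in the unit ball that are large in modulus at `x`. -/
theorem exists_stronglyExposing_smul_near {ε η : ℝ} {x : X}
    (hP : ∀ (f : StrongDual 𝕜 X) (x : X), ‖f‖ = 1 → ‖x‖ = 1 → 1 - η < RCLike.re (f x) →
      ∃ g ∈ stronglyExposingFunctionals 𝕜 (Metric.closedBall (0 : X) 1), ∃ y : X,
        ‖g‖ = 1 ∧ ‖y‖ = 1 ∧ g y = 1 ∧ ‖f - g‖ < ε ∧ ‖x - y‖ < ε)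
    (hx : ‖x‖ = 1) {f : StrongDual 𝕜 X} (hf : ‖f‖ ≤ 1) {κ : ℝ} (hκ : κ ≤ η) (hκ1 : κ ≤ 1)
    (hfx : 1 - κ < ‖f x‖) :
    ∃ g ∈ stronglyExposingFunctionals 𝕜 (Metric.closedBall (0 : X) 1), ∃ y : X, ∃ c : 𝕜,
      ‖c‖ = 1 ∧ ‖g‖ = 1 ∧ ‖y‖ = 1 ∧ g y = 1 ∧ ‖f - c • g‖ < κ + ε ∧ ‖x - y‖ < ε := by
  have hfx0 : 0 < ‖f x‖ := by linarith
  have hxf : ‖f x‖ ≤ ‖f‖ := by simpa [hx] using f.le_opNorm x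
  have hf0 : 0 < ‖f‖ := hfx0.trans_le hxf
  have hne : f x ≠ 0 := norm_pos_iff.1 hfx0
  have hnK : ((‖f x‖ : ℝ) : 𝕜) ≠ 0 := by exact_mod_cast hfx0.ne'
  set c : 𝕜 := f x / (‖f x‖ : ℝ) with hc
  have hc1 : ‖c‖ = 1 := by simp [hc, hfx0.ne']
  have hc0 : c ≠ 0 := fun h => by simp [h] at hc1
  have hval : ((c⁻¹ * ((‖f‖ : ℝ) : 𝕜)⁻¹) • f) x = ((‖f x‖ / ‖f‖ : ℝ) : 𝕜) := by
    simp only [smul_apply, smul_eq_mul, hc, RCLike.ofReal_div]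
    field_simp
  obtain ⟨g, hg, y, hg1, hy, hgy, hfg, hxy⟩ := hP ((c⁻¹ * ((‖f‖ : ℝ) : 𝕜)⁻¹) • f) x
    (by simp [norm_smul, hc1, hf0.ne']) hx (by
      rw [hval, RCLike.ofReal_re]
      have : ‖f x‖ ≤ ‖f x‖ / ‖f‖ := le_div_self hfx0.le hf0 hf
      linarith)
  refine ⟨g, hg, y, c, hc1, hg1, hy, hgy, ?_, hxy⟩
  have e : f - c • g = (1 - ((‖f‖ : ℝ) : 𝕜)⁻¹) • f + c • ((c⁻¹ * ((‖f‖ : ℝ) : 𝕜)⁻¹) • f - g) := by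
    rw [smul_sub, smul_smul, mul_inv_cancel_left₀ hc0]
    ext z
    simp
    ring
  have e1 : ‖(1 - ((‖f‖ : ℝ) : 𝕜)⁻¹) • f‖ = 1 - ‖f‖ := by
    have : (1 - ((‖f‖ : ℝ) : 𝕜)⁻¹) = ((1 - ‖f‖⁻¹ : ℝ) : 𝕜) := by push_cast; rfl
    rw [this, norm_smul, RCLike.norm_ofReal, abs_sub_comm,
      abs_of_nonneg (sub_nonneg.2 ((one_le_inv₀ hf0).2 hf)), sub_mul, inv_mul_cancel₀ hf0.ne',
      one_mul]
  rw [e]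
  refine (norm_add_le _ _).trans_lt ?_
  rw [e1, norm_smul c, hc1, one_mul]
  linarith

theorem PropertyP.hasBPBpASE {ρ : ℝ} {Γ : Set (StrongDual 𝕜 Y)} (hY : HasACKStructure ρ Γ)
    {I : Submodule 𝕜 (X →L[𝕜] Y)} (hI : IsFlatIdeal Γ I) (hP : PropertyP 𝕜 X) :
    HasBPBpASE I := by
  obtain ⟨hρ0, hρ1, hΓ, hACK⟩ := hY
  obtain ⟨hflat, hfin, hideal⟩ := hI
  intro ε hε
  obtain ⟨δ, hδ0, hδ1, hδε⟩ : ∃ δ : ℝ, 0 < δ ∧ δ < 1 ∧ 3 * δ < ε :=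
    ⟨min ε 1 / 4, by positivity, by linarith [min_le_right ε 1], by
      linarith [min_le_left ε 1, lt_min hε one_pos]⟩
  obtain ⟨κ, hκ⟩ : ∃ κ : ℝ, κ = δ * (1 - ρ) / 12 := ⟨_, rfl⟩
  have hκ0 : 0 < κ := by
    have : 0 < 1 - ρ := by linarith
    rw [hκ]; positivity
  have hκδ : 12 * κ ≤ δ := by
    rw [hκ]; nlinarith
  obtain ⟨η₂, hη₂, hP⟩ := hP κ hκ0
  obtain ⟨η, hη0, hηη, hηκ⟩ : ∃ η : ℝ, 0 < η ∧ η ≤ η₂ ∧ η ≤ κ :=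
    ⟨min η₂ κ, by positivity, min_le_left _ _, min_le_right _ _⟩
  refine ⟨η, hη0, by linarith, fun T hT hT1 x hx hTx => ?_⟩
  obtain ⟨U, hUne, hUo, hUx, hUd⟩ := (hflat T hT).exists_relWeakStarOpen hΓ hTx hκ0
  have hUΓ : U ⊆ Γ := by
    obtain ⟨O, -, rfl⟩ := hUo
    exact inter_subset_left
  obtain ⟨f₀, hf₀⟩ := hUne
  obtain ⟨g, hg, y, c, hc, hg1, hy, hgy, hfg, hxy⟩ := exists_stronglyExposing_smul_near hP hx
    (f := f₀ ∘L T) ((f₀.opNorm_comp_le T).trans (by simpa [hT1] using hΓ.1 _ (hUΓ hf₀)))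
    hηη (by linarith) (hUx f₀ hf₀)
  obtain ⟨V, -, hVU, f₁, hf₁, e, he, F, hFe, hF, hf₁e, hf₁F, hsmall, hdist, hVe⟩ :=
    hACK κ hκ0 U ⟨f₀, hf₀⟩ hUo
  have hcg : ‖c • g‖ = 1 := by rw [norm_smul, hc, hg1, one_mul]
  set R : X →L[𝕜] Y := T - (c • g).smulRight e with hR
  have hR2 : ‖R‖ ≤ 2 := by
    refine (norm_sub_le _ _).trans ?_
    rw [ContinuousLinearMap.norm_smulRight_apply, hcg, he, hT1]
    norm_num
  have hVR : ∀ v ∈ V, ‖v ∘L R‖ ≤ 4 * κ := by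
    intro v hv
    have e1 : v ∘L R = (v ∘L T - f₀ ∘L T) + (f₀ ∘L T - c • g) - (v e - 1) • (c • g) := by
      ext z
      simp [hR]
      ring
    rw [e1]
    refine (norm_sub_le _ _).trans ?_
    have h1 := norm_add_le (v ∘L T - f₀ ∘L T) (f₀ ∘L T - c • g)
    have h2 := hUd v (hVU hv) f₀ hf₀
    have h3 : ‖(v e - 1) • (c • g)‖ ≤ κ := by
      rw [norm_smul, hcg, mul_one]; exact hVe v hv
    linarith
  have hFR : ∀ f ∈ Γ, ‖(f ∘L F) ∘L R‖ ≤ 6 * κ := by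
    intro f hf
    have := norm_comp_le_of_infDist_absConvexHull_lt (by positivity) hVR (hdist f hf)
    nlinarith
  have hRz : ∀ z : X, R z = T z - (c * g z) • e := fun z => by simp [hR]
  have hFRz : ∀ f ∈ Γ, ∀ z : X, ‖f (F (R z))‖ ≤ 6 * κ * ‖z‖ := fun f hf z =>
    ((f ∘L F) ∘L R).le_of_opNorm_le (hFR f hf) z
  set S : X →L[𝕜] Y := (c • g).smulRight (F e) + ((1 - δ : ℝ) : 𝕜) • (T - F ∘L T) with hS
  have hSz : ∀ z, S z = (c * g z) • F e + ((1 - δ : ℝ) : 𝕜) • (T z - F (T z)) := fun z => by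
    simp [hS]
  have hSI : S ∈ I := by
    refine I.add_mem (hfin _ ?_) (I.smul_mem _ (I.sub_mem hT (hideal T hT F)))
    refine Submodule.finiteDimensional_of_le (S₂ := Submodule.span 𝕜 {F e}) ?_
    rintro _ ⟨x, rfl⟩
    exact Submodule.smul_mem _ _ (Submodule.mem_span_singleton_self _)
  have hnδ : ‖((1 - δ : ℝ) : 𝕜)‖ = 1 - δ := by
    rw [RCLike.norm_ofReal, abs_of_nonneg (by linarith)]
  -- the bound from which both the norm of `S` and absolute strong exposition follow
  obtain ⟨q, hq1, hq⟩ : ∃ q < 1, ∀ z, ‖z‖ ≤ 1 → ‖S z‖ ≤ max ‖g z‖ q := by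
    have hκ1 : 0 < 1 - κ := by linarith
    refine ⟨max ((1 - δ) / (1 - κ)) (1 - 6 * κ), max_lt ?_ (by linarith), fun z hz => ?_⟩
    · rw [div_lt_one hκ1]; linarith
    refine hΓ.norm_le fun f hf => ?_
    have hTz : ‖T z‖ ≤ 1 := T.norm_apply_le_of_unit hT1.le hz
    have hgz : ‖g z‖ ≤ 1 := g.norm_apply_le_of_unit hg1.le hz
    by_cases hcase : ‖f ∘L F‖ + (1 - κ) * ‖f - f ∘L F‖ ≤ 1
    · set a := ‖f ∘L F‖ with ha
      set b := ‖f - f ∘L F‖ with hb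
      set m := max ‖g z‖ (max ((1 - δ) / (1 - κ)) (1 - 6 * κ)) with hm
      have h1 : ‖f (F e)‖ ≤ a := by simpa [he] using (f ∘L F).le_opNorm e
      have h2 : ‖f (T z - F (T z))‖ ≤ b := by
        have := (f - f ∘L F).le_of_opNorm_le_of_le le_rfl hTz
        simpa using this
      have hga : ‖g z‖ ≤ m := le_max_left _ _
      have hqm : (1 - δ) ≤ m * (1 - κ) := by
        rw [← div_le_iff₀ hκ1]
        exact (le_max_left _ _).trans (le_max_right _ _)
      have hm0 : 0 ≤ m := (norm_nonneg _).trans hga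
      have ha0 : 0 ≤ a := norm_nonneg _
      have hb0 : 0 ≤ b := norm_nonneg _
      calc ‖f (S z)‖ ≤ ‖(c * g z) * f (F e)‖ + ‖((1 - δ : ℝ) : 𝕜) * f (T z - F (T z))‖ := by
            rw [hSz, map_add, map_smul, map_smul]
            exact norm_add_le _ _
        _ = ‖g z‖ * ‖f (F e)‖ + (1 - δ) * ‖f (T z - F (T z))‖ := by
            rw [norm_mul, norm_mul, norm_mul, hnδ, hc, one_mul]
        _ ≤ m * a + m * (1 - κ) * b := by
            have : 0 ≤ 1 - δ := by linarith
            gcongr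
        _ = m * (a + (1 - κ) * b) := by ring
        _ ≤ m := mul_le_of_le_one_right hm0 hcase
    · have h1 : ‖f (F e)‖ ≤ ρ := hsmall f hf hcase
      have h2 : ‖f (F (R z))‖ ≤ 6 * κ :=
        (hFRz f hf z).trans (mul_le_of_le_one_right (by linarith) hz)
      have h3 : ‖f (T z)‖ ≤ 1 := f.norm_apply_le_of_unit (hΓ.1 f hf) hTz
      refine le_trans ?_ ((le_max_right _ _).trans (le_max_right _ _))
      have e1 : f (S z) = ((1 - δ : ℝ) : 𝕜) * f (T z) + (δ : 𝕜) * (c * g z) * f (F e)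
          - ((1 - δ : ℝ) : 𝕜) * f (F (R z)) := by
        rw [hSz, hRz]
        simp only [map_add, map_sub, map_smul, smul_eq_mul]
        push_cast
        ring
      have hnδ' : ‖(δ : 𝕜)‖ = δ := by rw [RCLike.norm_ofReal, abs_of_pos hδ0]
      calc ‖f (S z)‖ ≤ ‖((1 - δ : ℝ) : 𝕜) * f (T z)‖ + ‖(δ : 𝕜) * (c * g z) * f (F e)‖
            + ‖((1 - δ : ℝ) : 𝕜) * f (F (R z))‖ := by
            rw [e1]
            exact (norm_sub_le _ _).trans (by gcongr; exact norm_add_le _ _)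
        _ = (1 - δ) * ‖f (T z)‖ + δ * ‖g z‖ * ‖f (F e)‖ + (1 - δ) * ‖f (F (R z))‖ := by
            simp only [norm_mul, hnδ, hnδ', hc, one_mul]
        _ ≤ (1 - δ) * 1 + δ * 1 * ρ + 1 * (6 * κ) := by
            gcongr
            linarith
        _ = 1 - 6 * κ := by rw [hκ]; ring
  have hSle : ∀ z, ‖z‖ ≤ 1 → ‖S z‖ ≤ 1 := fun z hz =>
    (hq z hz).trans (max_le (g.norm_apply_le_of_unit hg1.le hz) hq1.le)
  have hSy : ‖S y‖ = 1 := by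
    refine le_antisymm (hSle y hy.le) ?_
    have h1 : f₁ (S y) = c := by
      have : ∀ w, f₁ (F w) = f₁ w := fun w => DFunLike.congr_fun hf₁F w
      rw [hSz]
      simp [hf₁e, hgy, this (T y)]
    rw [← hc, ← h1]
    exact (f₁.le_of_opNorm_le (hΓ.1 _ (hUΓ (hVU hf₁))) _).trans (by simp)
  have hS1 : ‖S‖ = 1 := by
    refine le_antisymm (S.opNorm_le_of_unit_norm zero_le_one fun z hz => hSle z hz.le) ?_
    · simpa [hSy, hy] using S.le_opNorm y
  refine ⟨S, hSI, ⟨y, hy, fun z hz hlim => ?_⟩, y, hy, hS1, hSy, ?_, by linarith⟩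
  · rw [hS1] at hlim
    refine exists_subseq_tendsto_of_norm_tendsto hg hg1 hy.le hgy hz ?_
    refine tendsto_of_tendsto_of_tendsto_of_le_of_le' hlim tendsto_const_nhds ?_
      (Eventually.of_forall fun n => g.norm_apply_le_of_unit hg1.le (hz n))
    filter_upwards [hlim.eventually (lt_mem_nhds hq1)] with n hn
    rcases le_max_iff.1 (hq (z n) (hz n)) with h | h
    · exact h
    · exact absurd h (not_le.2 hn)
  · refine lt_of_le_of_lt (ContinuousLinearMap.opNorm_le_bound _ (by positivity : 0 ≤ 3 * δ)
      fun z => hΓ.norm_le fun f hf => ?_) hδε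
    have h1 := hFRz f hf z
    have hfn := hΓ.1 f hf
    have h2 : ‖f (T z)‖ ≤ ‖z‖ := by
      refine (f.le_of_opNorm_le hfn _).trans ?_
      simpa [hT1] using T.le_opNorm z
    have h3 : ‖f (F (T z))‖ ≤ ‖z‖ := by
      refine (f.le_of_opNorm_le hfn _).trans ?_
      rw [one_mul]
      refine (F.le_of_opNorm_le hF.le _).trans ?_
      simpa [hT1] using T.le_opNorm z
    have e1 : f ((S - T) z) = -f (F (R z)) - (δ : 𝕜) * (f (T z) - f (F (T z))) := by
      rw [sub_apply, hSz, hRz]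
      simp only [map_add, map_sub, map_smul, smul_eq_mul]
      push_cast
      ring
    rw [e1]
    refine (norm_sub_le _ _).trans ?_
    rw [norm_neg, norm_mul, RCLike.norm_ofReal, abs_of_pos hδ0]
    have h4 := norm_sub_le (f (T z)) (f (F (T z)))
    nlinarith [norm_nonneg z]

theorem HasACKStructure.nontrivial {ρ : ℝ} {Γ : Set (StrongDual 𝕜 Y)}
    (hY : HasACKStructure ρ Γ) : Nontrivial Y := by
  obtain ⟨-, -, hΓ, hACK⟩ := hY
  have hne : Γ.Nonempty := by
    by_contra h
    rw [not_nonempty_iff_eq_empty] at h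
    have := hΓ.norm_le (y := 0) (c := -1) (by simp [h])
    simp at this
    linarith
  obtain ⟨-, -, -, -, -, e, he, -⟩ := hACK 1 one_pos Γ hne ⟨univ, isOpen_univ, by simp⟩
  exact ⟨e, 0, fun h => by simp [h] at he⟩

end Auxiliary

theorem mainTheorem9 {𝕜 : Type*} [RCLike 𝕜]
    {X : Type*} [NormedAddCommGroup X] [NormedSpace 𝕜 X] [CompleteSpace X]
    {Y : Type*} [NormedAddCommGroup Y] [NormedSpace 𝕜 Y] [CompleteSpace Y]
    (ρ : ℝ) (Γ : Set (StrongDual 𝕜 Y)) (hY : HasACKStructure ρ Γ)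
    (I : Submodule 𝕜 (X →L[𝕜] Y)) (hI : IsFlatIdeal Γ I) :
    HasBPBpASE I ↔ PropertyP 𝕜 X := by
  have := hY.nontrivial
  exact ⟨fun h => h.propertyP hI.2.1, fun h => h.hasBPBpASE hY hI⟩
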